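/- Let $L, d_0, \dots, d_L$ be nonnegative integers, and for real matrices $W_\ell \in \mathbb{R}^{d_\ell \times d_{\ell-1}}$, $\ell = 1,\dots,L$, and vectors $x \in \mathbb{R}^{d_0}$, $y \in \mathbb{R}^{d_L}$ let $$\mathcal{L}(W_1,\dots,W_L,x,y) = \lVert y - W_L\cdots W_1 x\rVert_2^2$$ (the empty product is the identity matrix). Let $(\mathbf{X},\mathbf{Y})$ be a random vector in $\mathbb{R}^{d_0}\times\mathbb{R}^{d_L}$ with finite fourth moment, that is, $\mathbb{E}\lVert\mathbf{X}\rVert_2^4 < \infty$ and $\mathbb{E}\lVert\mathbf{Y}\rVert_2^4<\infty$. Let $n \geq 1$ and let $(\mathbf{X}_1,\mathbf{Y}_1),\dots,(\mathbf{X}_n,\mathbf{Y}_n)$ be independent copies of $(\mathbf{X},\mathbf{Y})$. Fix $\eta>0$ and $\delta\in(0,1)$. Given $(W_1,\dots,W_L)$, let $\widetilde W_\ell$ have the entries $\widetilde W_{\ell,ij} = W_{\ell,ij}+\xi_{\ell,ij}$, where the $\xi_{\ell,ij}$ (all $\ell,i,j$) are independent $\mathcal{N}(0,\eta^2)$ variables,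 independent of $(\mathbf{X},\mathbf{Y})$ and of the sample. Then, with probability at least $1-\delta$ over the draw of the sample, simultaneously for all parameters $(W_1,\dots,W_L)$ (so in particular for every parameter estimate computed from the sample), $$\begin{aligned} &\mathbb{E}\big[\mathcal{L}(W_1,\dots,W_L,\mathbf{X},\mathbf{Y})\big]-\frac1n\sum_{i=1}^n\mathcal{L}(W_1,\dots,W_L,\mathbf{X}_i,\mathbf{Y}_i)\\ &\quad\le\ \mathbb{E}_\xi\Big[\frac1n\sum_{i=1}^n\mathcal{L}(\widetilde W_1,\dots,\widetilde W_L,\mathbf{X}_i,\mathbf{Y}_i)\Big]-\frac1n\sum_{i=1}^n\mathcal{L}(W_1,\dots,W_L,\mathbf{X}_i,\mathbf{Y}_i)\\ &\qquad+\frac1{\sqrt n}\Big(\frac1{2\eta^2}\sum_{\ell=1}^L\lVert W_\ell\rVert^2+\log\frac1\delta+\frac12\,\mathbb{E}\big[\mathcal{L}(\widetilde W_1,\dots,\widetilde W_L,\mathbf{X},\mathbf{Y})^2\big]\Big), \end{aligned}$$ and all expectations occurring here are finite. Here $\lVert\cdot\rVert$ is the Frobenius norm, $\mathbb{E}_\xi$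 is the expectation over the $\xi_{\ell,ij}$ only, and $\mathbb{E}$ is the expectation over $(\mathbf{X},\mathbf{Y})$ and, in the last term, also over the $\xi_{\ell,ij}$, with $(W_1,\dots,W_L)$ held fixed. -/

import Mathlib

open MeasureTheory ProbabilityTheory
open scoped NNReal ENNReal Matrix

noncomputable section

/-- The parameters `(W_1, …, W_L)` of a linear network with layer widths `d_0, …, d_L`.
The matrix with index `ℓ : Fin L` has size `d_{ℓ+1} × d_ℓ`
(the index is shifted by one: it starts at zero). -/
abbrev LinNetWeights {L : ℕ} (d : Fin (L + 1) → ℕ) : Type :=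
  (ℓ : Fin L) → Matrix (Fin (d ℓ.succ)) (Fin (d ℓ.castSucc)) ℝ

/-- The partial product `W_ℓ ⋯ W_1`, a `d_ℓ × d_0` matrix; the empty product is the identity. -/
def LinNetWeights.partialProd {L : ℕ} {d : Fin (L + 1) → ℕ} (W : LinNetWeights d)
    (ℓ : Fin (L + 1)) : Matrix (Fin (d ℓ)) (Fin (d 0)) ℝ :=
  Fin.induction (motive := fun k => Matrix (Fin (d k)) (Fin (d 0)) ℝ) 1
    (fun k A => W k * A) ℓ

/-- The full product `W_L ⋯ W_1`, a `d_L × d_0` matrix. -/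
def LinNetWeights.fullProd {L : ℕ} {d : Fin (L + 1) → ℕ} (W : LinNetWeights d) :
    Matrix (Fin (d (Fin.last L))) (Fin (d 0)) ℝ :=
  W.partialProd (Fin.last L)

/-- The quadratic loss `‖y - W_L ⋯ W_1 x‖₂²` (Euclidean norm). -/
def LinNetWeights.loss {L : ℕ} {d : Fin (L + 1) → ℕ} (W : LinNetWeights d)
    (x : EuclideanSpace ℝ (Fin (d 0))) (y : EuclideanSpace ℝ (Fin (d (Fin.last L)))) : ℝ :=
  ‖y - WithLp.toLp 2 (W.fullProd *ᵥ x.ofLp)‖ ^ 2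

/-- The sum over all layers of the squared Frobenius norms, `∑_ℓ ‖W_ℓ‖²`. -/
def LinNetWeights.normSq {L : ℕ} {d : Fin (L + 1) → ℕ} (W : LinNetWeights d) : ℝ :=
  ∑ ℓ, ∑ i, ∑ j, W ℓ i j ^ 2

/-- The set of all entries `(ℓ, i, j)` of all weight matrices. -/
abbrev LinNetIndex {L : ℕ} (d : Fin (L + 1) → ℕ) : Type :=
  (ℓ : Fin L) × (Fin (d ℓ.succ) × Fin (d ℓ.castSucc))

/-- The joint law of the perturbations `ξ_{ℓ,ij}`: independent `N(0, η²)` variables,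
one for every entry of every weight matrix. -/
def linNetNoise {L : ℕ} (d : Fin (L + 1) → ℕ) (η : ℝ) : Measure (LinNetIndex d → ℝ) :=
  Measure.pi fun _ => gaussianReal 0 (Real.toNNReal (η ^ 2))

/-- The perturbed parameters with entries `W_{ℓ,ij} + ξ_{ℓ,ij}`. -/
def LinNetWeights.perturb {L : ℕ} {d : Fin (L + 1) → ℕ} (W : LinNetWeights d)
    (ξ : LinNetIndex d → ℝ) : LinNetWeights d :=
  fun ℓ => Matrix.of fun i j => W ℓ i j + ξ ⟨ℓ, (i, j)⟩

end

/-! ### Exponential moments of nonnegative losses -/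

/-! This is a PAC-Bayes argument with prior `N(0, η²)` on all weight entries and posterior `N(W,
η²)`, the law of the perturbed weights; their relative entropy is `‖W‖² / (2η²)`.

For fixed weights the loss is nonnegative, so its downward deviations are controlled by the second
moment alone (`lintegral_exp_deviation_le_one`). Averaging this exponential moment over the prior
and applying Markov's inequality gives one good event on which the prior average is at most `1/δ`.
The prior ignores `W`, so the Donsker-Varadhan inequality (`ofReal_exp_integral_shift_le`) transfers
the bound to all posteriors at once (`exists_pacBayes_gaussian`).

This bounds the posterior mean of the population loss. It dominates the population loss at `W`
itself: the perturbed product of matrices is unbiased, as the layers carry independent centred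
noise, and the loss is convex in the product (`loss_le_integral_loss_perturb`). -/

lemma exp_neg_le_quadratic {x : ℝ} (hx : 0 ≤ x) : Real.exp (-x) ≤ 1 - x + x ^ 2 / 2 := by
  have h := Real.quadratic_le_exp_of_nonneg hx
  have hq : 0 < 1 - x + x ^ 2 / 2 := by nlinarith [sq_nonneg (x - 1)]
  -- `(1 - x + x²/2)(1 + x + x²/2) = 1 + x⁴/4`.
  have hprod : 1 ≤ (1 - x + x ^ 2 / 2) * Real.exp x := by
    nlinarith [mul_le_mul_of_nonneg_left h hq.le, sq_nonneg (x ^ 2)]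
  rw [Real.exp_neg, inv_le_iff_one_le_mul₀ (Real.exp_pos x)]
  exact hprod

lemma integrable_of_integrable_sq {α : Type*} [MeasurableSpace α] {μ : Measure α}
    [IsFiniteMeasure μ] {f : α → ℝ} (hf : AEStronglyMeasurable f μ)
    (h2 : Integrable (fun z => f z ^ 2) μ) : Integrable f μ :=
  ((memLp_two_iff_integrable_sq hf).2 h2).integrable one_le_two

lemma integrable_exp_of_nonneg {α : Type*} [MeasurableSpace α] {μ : Measure α}
    [IsFiniteMeasure μ] {f : α → ℝ} (hf : Measurable f) (h0 : ∀ z, 0 ≤ f z) (a : ℝ) {t : ℝ}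
    (ht : 0 ≤ t) : Integrable (fun z => Real.exp (a - t * f z)) μ := by
  refine Integrable.of_bound (C := Real.exp a) (by fun_prop) (ae_of_all _ fun z => ?_)
  rw [Real.norm_eq_abs, Real.abs_exp]
  exact Real.exp_le_exp.2 (by nlinarith [mul_nonneg ht (h0 z)])

/-- For `f ≥ 0` the quadratic bound on `exp (-t f)` integrates to `1 - a ≤ exp (-a)`, where `a` is
the constant part of the exponent. No upper tail of `f` enters beyond its second moment. -/
lemma integral_exp_le_one_of_nonneg {α : Type*} [MeasurableSpace α] {μ : Measure α}
    [IsProbabilityMeasure μ] {f : α → ℝ} (hf : Measurable f) (h0 : ∀ z, 0 ≤ f z)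
    (h2 : Integrable (fun z => f z ^ 2) μ) {t : ℝ} (ht : 0 ≤ t) :
    ∫ z, Real.exp ((t * (∫ y, f y ∂μ) - t ^ 2 / 2 * ∫ y, f y ^ 2 ∂μ) - t * f z) ∂μ ≤ 1 := by
  have h1 := integrable_of_integrable_sq hf.aestronglyMeasurable h2
  set a := t * (∫ y, f y ∂μ) - t ^ 2 / 2 * ∫ y, f y ^ 2 ∂μ with ha
  have hle : ∫ z, Real.exp (-(t * f z)) ∂μ ≤ 1 - a := by
    have hlin : Integrable (fun z => 1 - t * f z) μ := (integrable_const _).sub (h1.const_mul t)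
    have hint : Integrable (fun z => 1 - t * f z + t ^ 2 / 2 * f z ^ 2) μ :=
      hlin.add (h2.const_mul _)
    calc ∫ z, Real.exp (-(t * f z)) ∂μ ≤ ∫ z, (1 - t * f z + t ^ 2 / 2 * f z ^ 2) ∂μ := by
          refine integral_mono ?_ hint fun z => ?_
          · simpa using integrable_exp_of_nonneg (μ := μ) hf h0 0 ht
          · have := exp_neg_le_quadratic (mul_nonneg ht (h0 z))
            simp only
            linarith [this, mul_pow t (f z) 2]
      _ = 1 - a := by
          rw [integral_add hlin (h2.const_mul _),
            integral_sub (integrable_const _) (h1.const_mul t), integral_const_mul,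
            integral_const_mul]
          simp [ha]
          ring
  calc ∫ z, Real.exp (a - t * f z) ∂μ = Real.exp a * ∫ z, Real.exp (-(t * f z)) ∂μ := by
        rw [← integral_const_mul]
        simp_rw [← Real.exp_add, sub_eq_add_neg]
    _ ≤ Real.exp a * Real.exp (-a) := by
        gcongr
        exact hle.trans (by linarith [Real.add_one_le_exp (-a)])
    _ = 1 := by rw [← Real.exp_add]; simp

/-- For an i.i.d. sample of size `n`, the deviation of the empirical mean of a nonnegative
function below its expectation has a controlled exponential moment. -/
lemma lintegral_exp_deviation_le_one {α : Type*} [MeasurableSpace α] {μ : Measure α}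
    [IsProbabilityMeasure μ] {f : α → ℝ} (hf : Measurable f) (h0 : ∀ z, 0 ≤ f z)
    (h2 : Integrable (fun z => f z ^ 2) μ) {n : ℕ} (hn : 1 ≤ n) :
    ∫⁻ z : Fin n → α, ENNReal.ofReal (Real.exp
      (√(n : ℝ) * ((∫ y, f y ∂μ) - (1 / (n : ℝ)) * ∑ i, f (z i))
        - (1 / 2) * ∫ y, f y ^ 2 ∂μ)) ∂(Measure.pi fun _ => μ) ≤ 1 := by
  have hn' : (0 : ℝ) < n := by exact_mod_cast hn
  have hs : 0 < √(n : ℝ) := Real.sqrt_pos.2 hn'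
  have hss : √(n : ℝ) ^ 2 = n := Real.sq_sqrt hn'.le
  -- This choice gives `n t = √n` and `n t² / 2 = 1/2`, so the exponent splits into `n` i.i.d. terms
  -- `a - t * f (z i)`.
  set t := 1 / √(n : ℝ) with ht
  have ht0 : 0 ≤ t := by positivity
  set a := t * (∫ y, f y ∂μ) - t ^ 2 / 2 * ∫ y, f y ^ 2 ∂μ with ha
  have key : ∀ s m A B C : ℝ, 0 < s → s ^ 2 = m →
      s * (A - 1 / m * C) - 1 / 2 * B = m * (1 / s * A - (1 / s) ^ 2 / 2 * B) - 1 / s * C := by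
    rintro s m A B C h0 rfl
    field_simp
    ring
  have hprod : ∀ z : Fin n → α, Real.exp
      (√(n : ℝ) * ((∫ y, f y ∂μ) - (1 / (n : ℝ)) * ∑ i, f (z i))
        - (1 / 2) * ∫ y, f y ^ 2 ∂μ) = ∏ i, Real.exp (a - t * f (z i)) := by
    intro z
    rw [← Real.exp_sum, Finset.sum_sub_distrib, ← Finset.mul_sum]
    congr 1
    simp only [Finset.sum_const, Finset.card_univ, Fintype.card_fin, nsmul_eq_mul, ha, ht]
    exact key _ _ _ _ _ hs hss
  simp_rw [hprod]
  rw [← ofReal_integral_eq_lintegral_ofReal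
    (Integrable.fintype_prod fun _ => integrable_exp_of_nonneg hf h0 a ht0)
    (ae_of_all _ fun z => Finset.prod_nonneg fun i _ => (Real.exp_pos _).le),
    integral_fintype_prod_eq_prod (fun (_ : Fin n) z => Real.exp (a - t * f z))]
  refine ENNReal.ofReal_le_one.2 (Finset.prod_le_one (fun i _ => ?_) fun i _ => ?_)
  · exact integral_nonneg fun z => (Real.exp_pos _).le
  · exact integral_exp_le_one_of_nonneg hf h0 h2 ht0

/-! ### Change of measure for shifted Gaussian product measures -/

lemma gaussianReal_neg_eq_withDensity (w : ℝ) {v : ℝ≥0} (hv : v ≠ 0) :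
    gaussianReal (-w) v = (gaussianReal 0 v).withDensity
      fun x => ENNReal.ofReal (Real.exp (-(w * x) / v - w ^ 2 / (2 * v))) := by
  rw [gaussianReal_of_var_ne_zero _ hv, gaussianReal_of_var_ne_zero _ hv,
    ← withDensity_mul _ (measurable_gaussianPDF _ _) (by fun_prop)]
  congr 1
  ext x
  have hv' : (v : ℝ) ≠ 0 := by exact_mod_cast hv
  simp only [Pi.mul_apply, gaussianPDF_def, gaussianPDFReal_def]
  rw [← ENNReal.ofReal_mul (by positivity), mul_assoc _ (Real.exp _) (Real.exp _),
    ← Real.exp_add]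
  congr 3
  field_simp
  ring

/-- It suffices to compare on boxes, where the indicator factors over the coordinates and so does
the integral. -/
lemma pi_withDensity_ofReal {ι : Type*} [Fintype ι] {α : ι → Type*} [∀ i, MeasurableSpace (α i)]
    (μ : ∀ i, Measure (α i)) [∀ i, IsProbabilityMeasure (μ i)] (f : ∀ i, α i → ℝ)
    (hf0 : ∀ i x, 0 ≤ f i x) (hf : ∀ i, Integrable (f i) (μ i)) :
    Measure.pi (fun i => (μ i).withDensity fun x => ENNReal.ofReal (f i x)) =
      (Measure.pi μ).withDensity fun x => ENNReal.ofReal (∏ i, f i (x i)) := by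
  have : ∀ i, IsFiniteMeasure ((μ i).withDensity fun x => ENNReal.ofReal (f i x)) :=
    fun i => isFiniteMeasure_withDensity_ofReal (hf i).2
  refine Measure.pi_eq fun s hs => ?_
  rw [withDensity_apply _ (MeasurableSet.univ_pi hs), ← lintegral_indicator (MeasurableSet.univ_pi hs)]
  have hind : ∀ x : ∀ i, α i, (Set.univ.pi s).indicator
      (fun x => ENNReal.ofReal (∏ i, f i (x i))) x =
        ENNReal.ofReal (∏ i, (s i).indicator (f i) (x i)) := by
    intro x
    by_cases hx : x ∈ Set.univ.pi s
    · rw [Set.indicator_of_mem hx]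
      congr 1
      exact Finset.prod_congr rfl fun i _ => (Set.indicator_of_mem (hx i trivial) _).symm
    · rw [Set.indicator_of_notMem hx]
      simp only [Set.mem_univ_pi, not_forall] at hx
      obtain ⟨i, hi⟩ := hx
      rw [Finset.prod_eq_zero (Finset.mem_univ i) (Set.indicator_of_notMem hi _)]
      simp
  have hn : ∀ i x, 0 ≤ (s i).indicator (f i) x :=
    fun i x => Set.indicator_nonneg (fun x _ => hf0 i x) x
  simp_rw [hind]
  rw [← ofReal_integral_eq_lintegral_ofReal
    (Integrable.fintype_prod_dep fun i => (hf i).indicator (hs i))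
    (ae_of_all _ fun x => Finset.prod_nonneg fun i _ => hn i _),
    integral_fintype_prod_eq_prod (fun i => (s i).indicator (f i)),
    ENNReal.ofReal_prod_of_nonneg fun i _ => integral_nonneg (hn i)]
  refine Finset.prod_congr rfl fun i _ => ?_
  rw [withDensity_apply _ (hs i), integral_indicator (hs i),
    ofReal_integral_eq_lintegral_ofReal (hf i).restrict (ae_of_all _ (hf0 i))]

/-- The Cameron-Martin formula for a shift of a centred isotropic Gaussian measure. -/
lemma lintegral_shift_gaussian {ι : Type*} [Fintype ι] {v : ℝ≥0} (hv : v ≠ 0) (w : ι → ℝ)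
    {g : (ι → ℝ) → ℝ≥0∞} (hg : Measurable g) :
    ∫⁻ u, g u ∂(Measure.pi fun _ => gaussianReal 0 v) =
      ∫⁻ u, ENNReal.ofReal (Real.exp (-(∑ i, w i * u i) / v - (∑ i, w i ^ 2) / (2 * v)))
        * g (w + u) ∂(Measure.pi fun _ => gaussianReal 0 v) := by
  -- Translation by `w` carries `N(-w, v)` to `N(0, v)`; the density of `N(-w, v)` then returns
  -- everything to the centred measure.
  have hmp : MeasurePreserving (fun (u : ι → ℝ) i => w i + u i)
      (Measure.pi fun i => gaussianReal (-w i) v) (Measure.pi fun _ => gaussianReal 0 v) :=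
    measurePreserving_pi _ _ fun i =>
      ⟨by fun_prop, by rw [gaussianReal_map_const_add]; simp⟩
  rw [← hmp.lintegral_comp hg]
  simp_rw [gaussianReal_neg_eq_withDensity _ hv]
  rw [pi_withDensity_ofReal (fun _ : ι => gaussianReal 0 v)
      (fun i x => Real.exp (-(w i * x) / v - w i ^ 2 / (2 * v))) (fun _ _ => (Real.exp_pos _).le),
    lintegral_withDensity_eq_lintegral_mul _ (by fun_prop) (by fun_prop)]
  · refine lintegral_congr fun u => ?_
    simp only [Pi.mul_apply]
    rw [← Real.exp_sum, Finset.sum_sub_distrib, ← Finset.sum_div, ← Finset.sum_div,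
      Finset.sum_neg_distrib]
    rfl
  · intro i
    have := (integrable_exp_mul_gaussianReal (μ := 0) (v := v) (-w i / v)).mul_const
      (Real.exp (-(w i ^ 2 / (2 * v))))
    refine this.congr (ae_of_all _ fun x => ?_)
    simp only [← Real.exp_add]
    congr 1
    ring

/-- The Donsker-Varadhan inequality for the posterior `N(w, v)` and the prior `N(0, v)`, whose
relative entropy is `‖w‖² / (2v)`. -/
lemma ofReal_exp_integral_shift_le {ι : Type*} [Fintype ι] {v : ℝ≥0} (hv : v ≠ 0) (w : ι → ℝ)
    {g : (ι → ℝ) → ℝ} (hg : Measurable g)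
    (hgi : Integrable (fun u => g (w + u)) (Measure.pi fun _ => gaussianReal 0 v)) :
    ENNReal.ofReal (Real.exp ((∫ u, g (w + u) ∂(Measure.pi fun _ => gaussianReal 0 v))
        - (∑ i, w i ^ 2) / (2 * v))) ≤
      ∫⁻ u, ENNReal.ofReal (Real.exp (g u)) ∂(Measure.pi fun _ => gaussianReal 0 v) := by
  set π : Measure (ι → ℝ) := Measure.pi fun _ => gaussianReal 0 v with hπ
  set c := (∑ i, w i ^ 2) / (2 * v)
  have hcoord : ∀ i, Integrable (fun u : ι → ℝ => u i) π := fun i =>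
    integrable_comp_eval (μ := fun _ : ι => gaussianReal 0 v) (i := i) (f := fun x => x)
      ((memLp_id_gaussianReal 1).integrable (by simp))
  have hcoord0 : ∀ i, ∫ u, u i ∂π = 0 := fun i => by
    rw [hπ, integral_comp_eval (μ := fun _ : ι => gaussianReal 0 v) (i := i) (f := fun x => x)
      (by fun_prop), integral_id_gaussianReal]
  have hlin : Integrable (fun u : ι → ℝ => -(∑ i, w i * u i) / v - c) π :=
    (((integrable_finsetSum _ fun i _ => (hcoord i).const_mul (w i)).neg).div_const _).sub
      (integrable_const _)
  have hlin0 : ∫ u, (-(∑ i, w i * u i) / v - c) ∂π = -c := by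
    rw [integral_sub _ (integrable_const _), integral_div, integral_neg,
      integral_finsetSum _ fun i _ => (hcoord i).const_mul (w i)]
    · simp [integral_const_mul, hcoord0]
    · exact ((integrable_finsetSum _ fun i _ => (hcoord i).const_mul (w i)).neg).div_const _
  have hsum : ∫ u, ((-(∑ i, w i * u i) / v - c) + g (w + u)) ∂π = (∫ u, g (w + u) ∂π) - c := by
    rw [integral_add hlin hgi, hlin0]
    ring
  -- Jensen's inequality for `exp` after the shift: the linear part of the log-density has mean
  -- zero, so only `-c` survives.
  rw [lintegral_shift_gaussian hv w (by fun_prop), ← hπ, ← hsum]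
  simp_rw [← ENNReal.ofReal_mul (Real.exp_pos _).le, ← Real.exp_add]
  set G := fun u => (-(∑ i, w i * u i) / v - c) + g (w + u) with hG
  have hGm : Measurable G := by fun_prop
  by_cases hfin : Integrable (fun u => Real.exp (G u)) π
  · rw [← ofReal_integral_eq_lintegral_ofReal hfin (ae_of_all _ fun u => (Real.exp_pos _).le)]
    exact ENNReal.ofReal_le_ofReal (convexOn_exp.map_integral_le Real.continuous_exp.continuousOn
      isClosed_univ (ae_of_all _ fun _ => trivial) (hlin.add hgi) hfin)
  · have : ∫⁻ u, ENNReal.ofReal (Real.exp (G u)) ∂π = ∞ := by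
      by_contra hne
      refine hfin ⟨by fun_prop, ?_⟩
      rw [hasFiniteIntegral_iff_ofReal (ae_of_all _ fun u => (Real.exp_pos _).le)]
      exact lt_top_iff_ne_top.2 hne
    rw [this]
    exact le_top

/-! ### A PAC-Bayes bound with Gaussian prior and posterior -/

/-- A PAC-Bayes bound for nonnegative, possibly unbounded losses `f u z` with parameter `u`, for
the prior `N(0, v)` and, simultaneously, all posteriors `N(w, v)`. -/
lemma exists_pacBayes_gaussian {ι : Type*} [Fintype ι] {v : ℝ≥0} (hv : v ≠ 0)
    {α : Type*} [MeasurableSpace α] (ν : Measure α) [IsProbabilityMeasure ν]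
    {f : (ι → ℝ) → α → ℝ} (hf : Measurable (Function.uncurry f)) (h0 : ∀ u z, 0 ≤ f u z)
    (h2 : ∀ u, Integrable (fun z => f u z ^ 2) ν)
    (hprod : ∀ w, Integrable (fun p : (ι → ℝ) × α => f (w + p.1) p.2 ^ 2)
      ((Measure.pi fun _ => gaussianReal 0 v).prod ν))
    (hz : ∀ w z, Integrable (fun u => f (w + u) z) (Measure.pi fun _ => gaussianReal 0 v))
    {n : ℕ} (hn : 1 ≤ n) {δ : ℝ} (hδ : 0 < δ) :
    ∃ G : Set (Fin n → α), MeasurableSet G ∧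
      ENNReal.ofReal (1 - δ) ≤ Measure.pi (fun _ => ν) G ∧
      ∀ z ∈ G, ∀ w : ι → ℝ,
        ∫ u, ∫ y, f (w + u) y ∂ν ∂(Measure.pi fun _ => gaussianReal 0 v) ≤
          (∫ u, (1 / (n : ℝ)) * ∑ i, f (w + u) (z i) ∂(Measure.pi fun _ => gaussianReal 0 v))
            + (1 / √(n : ℝ)) * ((1 / (2 * (v : ℝ))) * (∑ i, w i ^ 2) + Real.log (1 / δ)
              + (1 / 2) * ∫ p, f (w + p.1) p.2 ^ 2
                  ∂((Measure.pi fun _ => gaussianReal 0 v).prod ν)) := by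
  set π : Measure (ι → ℝ) := Measure.pi fun _ => gaussianReal 0 v with hπ
  have hn' : (0 : ℝ) < n := by exact_mod_cast hn
  have hs : 0 < √(n : ℝ) := Real.sqrt_pos.2 hn'
  have hm1 : Measurable fun u => ∫ y, f u y ∂ν :=
    hf.stronglyMeasurable.integral_prod_right.measurable
  have hm2 : Measurable fun u => ∫ y, f u y ^ 2 ∂ν :=
    (hf.pow_const 2).stronglyMeasurable.integral_prod_right.measurable
  have hm3 : ∀ i : Fin n, Measurable fun p : (Fin n → α) × (ι → ℝ) => f p.2 (p.1 i) := fun i =>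
    hf.comp (measurable_snd.prodMk ((measurable_pi_apply i).comp measurable_fst))
  let h : (Fin n → α) → (ι → ℝ) → ℝ := fun z u =>
    √(n : ℝ) * ((∫ y, f u y ∂ν) - (1 / (n : ℝ)) * ∑ i, f u (z i))
      - (1 / 2) * ∫ y, f u y ^ 2 ∂ν
  have hh : Measurable (Function.uncurry h) :=
    (((hm1.comp measurable_snd).sub
      ((Finset.measurable_fun_sum _ fun i _ => hm3 i).const_mul _)).const_mul _).sub
      ((hm2.comp measurable_snd).const_mul _)
  have hhe : Measurable fun p : (Fin n → α) × (ι → ℝ) =>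
      ENNReal.ofReal (Real.exp (h p.1 p.2)) := hh.exp.ennreal_ofReal
  let Z : (Fin n → α) → ℝ≥0∞ := fun z => ∫⁻ u, ENNReal.ofReal (Real.exp (h z u)) ∂π
  have hZ : Measurable Z := hhe.lintegral_prod_right'
  -- After Tonelli, `u` is fixed before the sample is drawn, so the bound for a single function
  -- applies.
  have hZ1 : ∫⁻ z, Z z ∂(Measure.pi fun _ => ν) ≤ 1 := by
    rw [lintegral_lintegral_swap hhe.aemeasurable]
    calc _ ≤ ∫⁻ _, 1 ∂π := lintegral_mono fun u =>
          lintegral_exp_deviation_le_one (hf.comp measurable_prodMk_left) (h0 u) (h2 u) hn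
      _ = 1 := by simp
  -- The event involves only the prior average `Z`, hence no `w`; this is what makes the bound
  -- uniform.
  refine ⟨{z | Z z ≤ ENNReal.ofReal (1 / δ)}, measurableSet_le hZ measurable_const, ?_, ?_⟩
  · have hmk := (mul_meas_ge_le_lintegral (μ := Measure.pi fun _ : Fin n => ν) hZ
      (ENNReal.ofReal (1 / δ))).trans hZ1
    have hbad : Measure.pi (fun _ => ν) {z | ENNReal.ofReal (1 / δ) ≤ Z z} ≤
        ENNReal.ofReal δ := by
      calc _ = ENNReal.ofReal δ * (ENNReal.ofReal (1 / δ) *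
            Measure.pi (fun _ => ν) {z | ENNReal.ofReal (1 / δ) ≤ Z z}) := by
            rw [← mul_assoc, ← ENNReal.ofReal_mul hδ.le, mul_one_div_cancel hδ.ne']
            simp
        _ ≤ ENNReal.ofReal δ * 1 := by gcongr
        _ = _ := mul_one _
    rw [← compl_compl {z | Z z ≤ ENNReal.ofReal (1 / δ)},
      prob_compl_eq_one_sub (measurableSet_le hZ measurable_const).compl,
      ENNReal.ofReal_sub _ hδ.le, ENNReal.ofReal_one]
    refine tsub_le_tsub_left ((measure_mono fun z hz => ?_).trans hbad) _
    have hz' : ¬ Z z ≤ ENNReal.ofReal (1 / δ) := hz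
    exact (not_le.1 hz').le
  · intro z hzG w
    have hfw : Measurable fun p : (ι → ℝ) × α => f (w + p.1) p.2 :=
      hf.comp (((measurable_const_add w).comp measurable_fst).prodMk measurable_snd)
    have hi1 : Integrable (fun u => ∫ y, f (w + u) y ∂ν) π :=
      (integrable_of_integrable_sq hfw.aestronglyMeasurable (hprod w)).integral_prod_left
    have hi2 : Integrable (fun u => ∫ y, f (w + u) y ^ 2 ∂ν) π := (hprod w).integral_prod_left
    have hi3 : Integrable (fun u => (1 / (n : ℝ)) * ∑ i, f (w + u) (z i)) π :=
      (integrable_finsetSum _ fun i _ => hz w (z i)).const_mul _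
    have hhi : Integrable (fun u => h z (w + u)) π :=
      ((hi1.sub hi3).const_mul _).sub (hi2.const_mul _)
    have hhv : ∫ u, h z (w + u) ∂π = √(n : ℝ) * ((∫ u, ∫ y, f (w + u) y ∂ν ∂π)
        - ∫ u, (1 / (n : ℝ)) * ∑ i, f (w + u) (z i) ∂π)
        - (1 / 2) * ∫ p, f (w + p.1) p.2 ^ 2 ∂(π.prod ν) := by
      have hi13 : Integrable (fun u => √(n : ℝ) * ((∫ y, f (w + u) y ∂ν)
          - (1 / (n : ℝ)) * ∑ i, f (w + u) (z i))) π := (hi1.sub hi3).const_mul _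
      simp only [h]
      rw [integral_sub hi13 (hi2.const_mul _), integral_const_mul, integral_const_mul,
        integral_sub hi1 hi3, integral_prod _ (hprod w)]
    have hdv := (ofReal_exp_integral_shift_le hv w (hh.comp measurable_prodMk_left) hhi).trans hzG
    rw [ENNReal.ofReal_le_ofReal_iff (by positivity)] at hdv
    have hlog := (Real.le_log_iff_exp_le (by positivity)).2 hdv
    rw [← hπ] at hlog
    change (∫ u, h z (w + u) ∂π) - _ ≤ _ at hlog
    rw [hhv] at hlog
    rw [← sub_le_iff_le_add', one_div_mul_eq_div, le_div_iff₀ hs, one_div_mul_eq_div (2 * (v : ℝ))]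
    linarith

/-! ### Moments of products of perturbed weight matrices -/

namespace LinNetWeights

variable {L : ℕ} {d : Fin (L + 1) → ℕ}

lemma partialProd_zero (W : LinNetWeights d) : W.partialProd 0 = 1 := rfl

lemma partialProd_succ (W : LinNetWeights d) (k : Fin L) :
    W.partialProd k.succ = W k * W.partialProd k.castSucc := rfl

lemma partialProd_succ_apply (W : LinNetWeights d) (k : Fin L) (i : Fin (d k.succ))
    (m : Fin (d 0)) :
    W.partialProd k.succ i m = ∑ j, W k i j * W.partialProd k.castSucc j m := rfl

/-- The partial product up to layer `k` depends only on the layers before `k`. -/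
lemma partialProd_congr {W W' : LinNetWeights d} (k : Fin (L + 1))
    (h : ∀ l : Fin L, l.castSucc < k → W l = W' l) : W.partialProd k = W'.partialProd k := by
  induction k using Fin.induction with
  | zero => rfl
  | succ k ih =>
    rw [partialProd_succ, partialProd_succ, h k Fin.castSucc_lt_succ,
      ih fun l hl => h l (hl.trans Fin.castSucc_lt_succ)]

lemma perturb_apply (W : LinNetWeights d) (u : LinNetIndex d → ℝ) (k : Fin L)
    (i : Fin (d k.succ)) (j : Fin (d k.castSucc)) :
    W.perturb u k i j = W k i j + u ⟨k, (i, j)⟩ := rfl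

/-- All entries of the weight matrices, as one vector. -/
def toVec (W : LinNetWeights d) : LinNetIndex d → ℝ := fun e => W e.1 e.2.1 e.2.2

/-- `perturb 0` reads a vector as weights. Translating the centred prior by `W.toVec` thus yields
exactly the noisy weights around `W`. -/
lemma perturb_zero_toVec_add (W : LinNetWeights d) (u : LinNetIndex d → ℝ) :
    perturb 0 (W.toVec + u) = W.perturb u := by
  funext k
  ext i j
  simp [perturb_apply, toVec]

lemma perturb_zero_toVec (W : LinNetWeights d) : perturb 0 W.toVec = W := by
  funext k
  ext i j
  simp [perturb_apply, toVec]

lemma toVec_perturb_zero (w : LinNetIndex d → ℝ) : (perturb (d := d) 0 w).toVec = w := by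
  funext e
  simp [perturb_apply, toVec]

lemma sum_sq_toVec (W : LinNetWeights d) : ∑ e, W.toVec e ^ 2 = W.normSq := by
  simp only [toVec, normSq, Fintype.sum_sigma, Fintype.sum_prod_type]

lemma measurable_partialProd_perturb (W : LinNetWeights d) (k : Fin (L + 1)) (i : Fin (d k))
    (m : Fin (d 0)) : Measurable fun u => (W.perturb u).partialProd k i m := by
  induction k using Fin.induction with
  | zero => exact measurable_const
  | succ k ih =>
    simp only [partialProd_succ_apply, perturb_apply]
    exact Finset.measurable_fun_sum _ fun j _ =>
      ((measurable_pi_apply _).const_add _).mul (ih j)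

instance (η : ℝ) : IsProbabilityMeasure (linNetNoise d η) := by
  unfold linNetNoise; infer_instance

lemma memLp_noise (η : ℝ) (e : LinNetIndex d) {p : ℝ≥0∞} (hp : p ≠ ∞) :
    MemLp (fun u : LinNetIndex d → ℝ => u e) p (linNetNoise d η) :=
  MemLp.comp_measurePreserving (memLp_id_gaussianReal' p hp)
    (measurePreserving_eval (fun _ : LinNetIndex d => gaussianReal 0 (Real.toNNReal (η ^ 2))) e)

/-- Hölder's inequality doubles the exponent at each layer, so the induction runs over all finite
`p` simultaneously. -/
lemma memLp_partialProd_perturb (W : LinNetWeights d) (η : ℝ) (k : Fin (L + 1)) (i : Fin (d k))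
    (m : Fin (d 0)) {p : ℝ≥0∞} (hp : p ≠ ∞) :
    MemLp (fun u => (W.perturb u).partialProd k i m) p (linNetNoise d η) := by
  induction k using Fin.induction generalizing p with
  | zero => exact memLp_const _
  | succ k ih =>
    have hp2 : 2 * p ≠ ∞ := ENNReal.mul_ne_top (by simp) hp
    have : ENNReal.HolderTriple (2 * p) (2 * p) p := ⟨by
      rw [ENNReal.mul_inv (by simp) (by simp), ← add_mul, ENNReal.inv_two_add_inv_two, one_mul]⟩
    simp only [partialProd_succ_apply, perturb_apply]
    refine memLp_finsetSum _ fun j _ => ?_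
    have hw : MemLp (fun u : LinNetIndex d → ℝ => W k i j + u ⟨k, (i, j)⟩) (2 * p)
        (linNetNoise d η) :=
      MemLp.add (memLp_const (W k i j)) (memLp_noise η ⟨k, (i, j)⟩ hp2)
    exact MemLp.mul' (ih j hp2) hw

/-- Flipping the sign of the noise in layer `k` preserves the law and leaves the product of the
earlier layers unchanged, so the integral equals its own negative. -/
lemma integral_noise_mul_partialProd_perturb (W : LinNetWeights d) (η : ℝ) (k : Fin L)
    (i : Fin (d k.succ)) (j j' : Fin (d k.castSucc)) (m : Fin (d 0)) :
    ∫ u, u ⟨k, (i, j)⟩ * (W.perturb u).partialProd k.castSucc j' m ∂(linNetNoise d η) = 0 := by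
  classical
  let φ : (LinNetIndex d → ℝ) → (LinNetIndex d → ℝ) :=
    fun u e => if e.1 = k then -u e else u e
  have hmp : MeasurePreserving φ (linNetNoise d η) (linNetNoise d η) := by
    refine measurePreserving_pi (f := fun (e : LinNetIndex d) x => if e.1 = k then -x else x)
      _ _ fun e => ?_
    by_cases he : e.1 = k
    · simp only [he, if_true]
      exact ⟨measurable_neg, by rw [gaussianReal_map_neg, neg_zero]⟩
    · simp only [he, if_false]
      exact MeasurePreserving.id _
  have hinv : ∀ u, (W.perturb (φ u)).partialProd k.castSucc =
      (W.perturb u).partialProd k.castSucc := fun u => by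
    refine partialProd_congr _ fun l hl => ?_
    have hlk : l ≠ k := fun h => by simp [h] at hl
    ext a b
    simp [perturb_apply, φ, hlk]
  have hmeas : Measurable fun u : LinNetIndex d → ℝ =>
      u ⟨k, (i, j)⟩ * (W.perturb u).partialProd k.castSucc j' m :=
    (measurable_pi_apply _).mul (measurable_partialProd_perturb W _ _ _)
  have hflip := integral_map hmp.measurable.aemeasurable
    (hmeas.aestronglyMeasurable (μ := (linNetNoise d η).map φ))
  rw [hmp.map_eq] at hflip
  simp only [hinv, φ, if_true, neg_mul, integral_neg] at hflip
  linarith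

lemma integral_partialProd_perturb (W : LinNetWeights d) (η : ℝ) (k : Fin (L + 1))
    (i : Fin (d k)) (m : Fin (d 0)) :
    ∫ u, (W.perturb u).partialProd k i m ∂(linNetNoise d η) = W.partialProd k i m := by
  induction k using Fin.induction with
  | zero => simp [partialProd_zero]
  | succ k ih =>
    have h1 : ∀ j, Integrable (fun u => W k i j * (W.perturb u).partialProd k.castSucc j m)
        (linNetNoise d η) := fun j =>
      ((memLp_partialProd_perturb W η _ j m ENNReal.one_ne_top).integrable le_rfl).const_mul _
    have h2 : ∀ j, Integrable (fun u : LinNetIndex d → ℝ =>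
        u ⟨k, (i, j)⟩ * (W.perturb u).partialProd k.castSucc j m) (linNetNoise d η) := fun j =>
      (memLp_noise η _ (p := 2) ENNReal.ofNat_ne_top).integrable_mul
        (memLp_partialProd_perturb W η _ j m (p := 2) ENNReal.ofNat_ne_top)
    have h12 : ∀ j, Integrable (fun u : LinNetIndex d → ℝ =>
        W k i j * (W.perturb u).partialProd k.castSucc j m +
          u ⟨k, (i, j)⟩ * (W.perturb u).partialProd k.castSucc j m) (linNetNoise d η) :=
      fun j => (h1 j).add (h2 j)
    simp only [partialProd_succ_apply, perturb_apply, add_mul]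
    rw [integral_finsetSum _ fun j _ => h12 j]
    refine Finset.sum_congr rfl fun j _ => ?_
    rw [integral_add (h1 j) (h2 j), integral_noise_mul_partialProd_perturb, integral_const_mul, ih,
      add_zero]

/-! ### The quadratic loss -/

lemma loss_nonneg (W : LinNetWeights d) (x : EuclideanSpace ℝ (Fin (d 0)))
    (y : EuclideanSpace ℝ (Fin (d (Fin.last L)))) : 0 ≤ W.loss x y := sq_nonneg _

lemma loss_eq_sum (W : LinNetWeights d) (x : EuclideanSpace ℝ (Fin (d 0)))
    (y : EuclideanSpace ℝ (Fin (d (Fin.last L)))) :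
    W.loss x y = ∑ i, (y i - ∑ j, W.partialProd (Fin.last L) i j * x j) ^ 2 := by
  rw [loss, EuclideanSpace.real_norm_sq_eq]
  rfl

/-- The squared Frobenius norm of the full product. -/
def fullProdNormSq (W : LinNetWeights d) : ℝ :=
  ∑ i, ∑ j, W.partialProd (Fin.last L) i j ^ 2

lemma loss_le (W : LinNetWeights d) (x : EuclideanSpace ℝ (Fin (d 0)))
    (y : EuclideanSpace ℝ (Fin (d (Fin.last L)))) :
    W.loss x y ≤ 2 * ‖y‖ ^ 2 + 2 * (W.fullProdNormSq * ‖x‖ ^ 2) := by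
  rw [loss_eq_sum, EuclideanSpace.real_norm_sq_eq, EuclideanSpace.real_norm_sq_eq, fullProdNormSq,
    Finset.sum_mul, Finset.mul_sum, Finset.mul_sum, ← Finset.sum_add_distrib]
  refine Finset.sum_le_sum fun i _ => ?_
  have hcs := Finset.sum_mul_sq_le_sq_mul_sq Finset.univ
    (fun j => W.partialProd (Fin.last L) i j) fun j => x j
  nlinarith [sq_nonneg (y i + ∑ j, W.partialProd (Fin.last L) i j * x j)]

lemma loss_sq_le (W : LinNetWeights d) (x : EuclideanSpace ℝ (Fin (d 0)))
    (y : EuclideanSpace ℝ (Fin (d (Fin.last L)))) :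
    W.loss x y ^ 2 ≤ 8 * ‖y‖ ^ 4 + 8 * (W.fullProdNormSq ^ 2 * ‖x‖ ^ 4) := by
  have h := pow_le_pow_left₀ (W.loss_nonneg x y) (W.loss_le x y) 2
  nlinarith [sq_nonneg (‖y‖ ^ 2 - W.fullProdNormSq * ‖x‖ ^ 2)]

lemma measurable_loss_perturb (W : LinNetWeights d) :
    Measurable fun p : (LinNetIndex d → ℝ) × (EuclideanSpace ℝ (Fin (d 0)) ×
      EuclideanSpace ℝ (Fin (d (Fin.last L)))) => (W.perturb p.1).loss p.2.1 p.2.2 := by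
  simp only [loss_eq_sum]
  have hA := fun i j => measurable_partialProd_perturb W (Fin.last L) i j
  refine Finset.measurable_fun_sum _ fun i _ => Measurable.pow_const (Measurable.sub ?_
    (Finset.measurable_fun_sum _ fun j _ => ((hA i j).comp measurable_fst).mul ?_)) 2
  · fun_prop
  · fun_prop

lemma measurable_loss (W : LinNetWeights d) :
    Measurable fun z : EuclideanSpace ℝ (Fin (d 0)) × EuclideanSpace ℝ (Fin (d (Fin.last L))) =>
      W.loss z.1 z.2 := by
  simpa only [Function.comp_def, perturb_zero_toVec] using
    (measurable_loss_perturb 0).comp (measurable_prodMk_left (x := W.toVec))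

lemma integrable_fullProdNormSq_perturb_sq (W : LinNetWeights d) (η : ℝ) :
    Integrable (fun u => (W.perturb u).fullProdNormSq ^ 2) (linNetNoise d η) := by
  refine MemLp.integrable_sq ?_
  refine memLp_finsetSum _ fun i _ => memLp_finsetSum _ fun j _ => ?_
  have : ENNReal.HolderTriple 4 4 2 := ⟨by
    rw [show (4 : ℝ≥0∞) = 2 * 2 by norm_num, ENNReal.mul_inv (by simp) (by simp), ← add_mul,
      ENNReal.inv_two_add_inv_two, one_mul]⟩
  have hA := memLp_partialProd_perturb W η (Fin.last L) i j (p := 4) ENNReal.ofNat_ne_top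
  simpa only [sq] using hA.mul' hA

section Integrability

variable {ν : Measure (EuclideanSpace ℝ (Fin (d 0)) × EuclideanSpace ℝ (Fin (d (Fin.last L))))}

lemma integrable_loss_sq (hX4 : MemLp (fun z => z.1) 4 ν) (hY4 : MemLp (fun z => z.2) 4 ν)
    (W : LinNetWeights d) : Integrable (fun z => W.loss z.1 z.2 ^ 2) ν := by
  refine Integrable.mono' ((hY4.integrable_norm_pow (by simp)).const_mul 8 |>.add
    (((hX4.integrable_norm_pow (by simp)).const_mul (W.fullProdNormSq ^ 2)).const_mul 8))
    (W.measurable_loss.pow_const 2).aestronglyMeasurable (ae_of_all _ fun z => ?_)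
  rw [Real.norm_of_nonneg (sq_nonneg _)]
  exact W.loss_sq_le z.1 z.2

variable [IsProbabilityMeasure ν]

lemma integrable_loss (hX4 : MemLp (fun z => z.1) 4 ν) (hY4 : MemLp (fun z => z.2) 4 ν)
    (W : LinNetWeights d) : Integrable (fun z => W.loss z.1 z.2) ν :=
  integrable_of_integrable_sq W.measurable_loss.aestronglyMeasurable
    (integrable_loss_sq hX4 hY4 W)

lemma integrable_loss_perturb_sq (hX4 : MemLp (fun z => z.1) 4 ν)
    (hY4 : MemLp (fun z => z.2) 4 ν) (W : LinNetWeights d) (η : ℝ) :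
    Integrable (fun p => (W.perturb p.1).loss p.2.1 p.2.2 ^ 2) ((linNetNoise d η).prod ν) := by
  refine Integrable.mono' ((((hY4.integrable_norm_pow (by simp)).comp_snd _).const_mul 8).add
    (((integrable_fullProdNormSq_perturb_sq W η).mul_prod
      (hX4.integrable_norm_pow (by simp))).const_mul 8))
    (W.measurable_loss_perturb.pow_const 2).aestronglyMeasurable (ae_of_all _ fun p => ?_)
  rw [Real.norm_of_nonneg (sq_nonneg _)]
  exact (W.perturb p.1).loss_sq_le p.2.1 p.2.2

end Integrability

lemma memLp_residual_perturb (W : LinNetWeights d) (η : ℝ) (x : EuclideanSpace ℝ (Fin (d 0)))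
    (y : EuclideanSpace ℝ (Fin (d (Fin.last L)))) (i : Fin (d (Fin.last L))) :
    MemLp (fun u => y i - ∑ j, (W.perturb u).partialProd (Fin.last L) i j * x j) 2
      (linNetNoise d η) :=
  (memLp_const _).sub (memLp_finsetSum _ fun j _ =>
    (memLp_partialProd_perturb W η _ i j ENNReal.ofNat_ne_top).mul_const _)

lemma integrable_loss_perturb (W : LinNetWeights d) (η : ℝ) (x : EuclideanSpace ℝ (Fin (d 0)))
    (y : EuclideanSpace ℝ (Fin (d (Fin.last L)))) :
    Integrable (fun u => (W.perturb u).loss x y) (linNetNoise d η) := by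
  simp only [loss_eq_sum]
  exact integrable_finsetSum _ fun i _ => (memLp_residual_perturb W η x y i).integrable_sq

/-- Perturbing the weights by centred independent noise does not decrease the expected loss. -/
lemma loss_le_integral_loss_perturb (W : LinNetWeights d) (η : ℝ)
    (x : EuclideanSpace ℝ (Fin (d 0))) (y : EuclideanSpace ℝ (Fin (d (Fin.last L)))) :
    W.loss x y ≤ ∫ u, (W.perturb u).loss x y ∂(linNetNoise d η) := by
  simp only [loss_eq_sum]
  rw [integral_finsetSum _ fun i _ => (memLp_residual_perturb W η x y i).integrable_sq]
  refine Finset.sum_le_sum fun i _ => ?_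
  have hr := memLp_residual_perturb W η x y i
  have hri := hr.integrable one_le_two
  have hA : ∀ j, Integrable (fun u => (W.perturb u).partialProd (Fin.last L) i j * x j)
      (linNetNoise d η) := fun j =>
    ((memLp_partialProd_perturb W η _ i j ENNReal.one_ne_top).integrable le_rfl).mul_const _
  have hmean : ∫ u, (y i - ∑ j, (W.perturb u).partialProd (Fin.last L) i j * x j)
      ∂(linNetNoise d η) = y i - ∑ j, W.partialProd (Fin.last L) i j * x j := by
    rw [integral_sub (integrable_const _) (integrable_finsetSum _ fun j _ => hA j),
      integral_finsetSum _ fun j _ => hA j]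
    simp [integral_mul_const, integral_partialProd_perturb]
  -- Jensen's inequality for the square, applied to each residual coordinate.
  rw [← hmean]
  exact (Even.convexOn_pow even_two).map_integral_le (continuous_pow 2).continuousOn isClosed_univ
    (ae_of_all _ fun _ => trivial) hri hr.integrable_sq

end LinNetWeights

theorem lemma2p3 {L : ℕ} (d : Fin (L + 1) → ℕ)
    -- the law of the pair (X, Y), with finite fourth moment
    (ν : Measure (EuclideanSpace ℝ (Fin (d 0)) × EuclideanSpace ℝ (Fin (d (Fin.last L)))))
    [IsProbabilityMeasure ν]
    (hX4 : MemLp (fun z => z.1) 4 ν) (hY4 : MemLp (fun z => z.2) 4 ν)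
    -- the i.i.d. sample
    {n : ℕ} (hn : 1 ≤ n)
    {Ω : Type*} [MeasurableSpace Ω] (P : Measure Ω) [IsProbabilityMeasure P]
    (X : Fin n → Ω → EuclideanSpace ℝ (Fin (d 0)))
    (Y : Fin n → Ω → EuclideanSpace ℝ (Fin (d (Fin.last L))))
    (hlaw : ∀ i, HasLaw (fun ω => (X i ω, Y i ω)) ν P)
    (hindep : iIndepFun (fun i ω => (X i ω, Y i ω)) P)
    (η : ℝ) (hη : 0 < η) (δ : ℝ) (hδ0 : 0 < δ) (hδ1 : δ < 1) :
    -- all expectations in the bound are finite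
    (∀ W : LinNetWeights d,
      Integrable (fun z => W.loss z.1 z.2) ν ∧
      (∀ x y, Integrable (fun ξ => (W.perturb ξ).loss x y) (linNetNoise d η)) ∧
      Integrable (fun p => (W.perturb p.1).loss p.2.1 p.2.2 ^ 2) ((linNetNoise d η).prod ν)) ∧
    -- with probability at least 1 - δ, the bound holds for all parameters simultaneously
    ∃ E : Set Ω, MeasurableSet E ∧ ENNReal.ofReal (1 - δ) ≤ P E ∧
      ∀ ω ∈ E, ∀ W : LinNetWeights d,
        (∫ z, W.loss z.1 z.2 ∂ν) - (1 / (n : ℝ)) * ∑ i, W.loss (X i ω) (Y i ω) ≤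
          (∫ ξ, (1 / (n : ℝ)) * ∑ i, (W.perturb ξ).loss (X i ω) (Y i ω) ∂(linNetNoise d η))
            - (1 / (n : ℝ)) * ∑ i, W.loss (X i ω) (Y i ω)
            + (1 / √(n : ℝ)) *
              ((1 / (2 * η ^ 2)) * W.normSq + Real.log (1 / δ)
                + (1 / 2) * ∫ p, (W.perturb p.1).loss p.2.1 p.2.2 ^ 2
                    ∂((linNetNoise d η).prod ν)) := by
  refine ⟨fun W => ⟨W.integrable_loss hX4 hY4, W.integrable_loss_perturb η,
    W.integrable_loss_perturb_sq hX4 hY4 η⟩, ?_⟩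
  have hη2 : 0 < η ^ 2 := by positivity
  have hv : Real.toNNReal (η ^ 2) ≠ 0 := by simpa using hη.ne'
  have hvr : ((Real.toNNReal (η ^ 2) : ℝ≥0) : ℝ) = η ^ 2 := Real.coe_toNNReal _ hη2.le
  obtain ⟨G, hG, hPG, hbound⟩ := exists_pacBayes_gaussian hv ν
    (f := fun u z => (LinNetWeights.perturb (d := d) 0 u).loss z.1 z.2)
    (LinNetWeights.measurable_loss_perturb 0) (fun _ _ => LinNetWeights.loss_nonneg _ _ _)
    (fun _ => LinNetWeights.integrable_loss_sq hX4 hY4 _)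
    (fun w => by
      rw [← LinNetWeights.toVec_perturb_zero w]
      simp only [LinNetWeights.perturb_zero_toVec_add]
      exact LinNetWeights.integrable_loss_perturb_sq hX4 hY4 _ η)
    (fun w z => by
      rw [← LinNetWeights.toVec_perturb_zero w]
      simp only [LinNetWeights.perturb_zero_toVec_add]
      exact LinNetWeights.integrable_loss_perturb _ η _ _)
    hn hδ0
  have hS : AEMeasurable (fun ω i => (X i ω, Y i ω)) P :=
    aemeasurable_pi_lambda _ fun i => (hlaw i).aemeasurable
  have hmap : P.map (fun ω i => (X i ω, Y i ω)) = Measure.pi fun _ => ν := by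
    rw [(iIndepFun_iff_map_fun_eq_pi_map fun i => (hlaw i).aemeasurable).1 hindep]
    simp_rw [(hlaw _).map_eq]
  -- The sample is only a.e. measurable, so the preimage of `G` is null-measurable and is shrunk to
  -- a measurable set of the same probability.
  obtain ⟨E, hEsub, hE, hEeq⟩ :=
    (hS.nullMeasurableSet_preimage hG).exists_measurable_subset_ae_eq
  refine ⟨E, hE, ?_, fun ω hω W => ?_⟩
  · rwa [measure_congr hEeq, ← Measure.map_apply_of_aemeasurable hS hG, hmap]
  · have hb := hbound _ (hEsub hω) W.toVec
    simp only [LinNetWeights.perturb_zero_toVec_add, LinNetWeights.sum_sq_toVec, hvr] at hb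
    have hprod : Integrable (fun p => (W.perturb p.1).loss p.2.1 p.2.2)
        ((linNetNoise d η).prod ν) :=
      integrable_of_integrable_sq W.measurable_loss_perturb.aestronglyMeasurable
        (W.integrable_loss_perturb_sq hX4 hY4 η)
    -- The Jensen gap is used only under the population law; the unperturbed empirical loss cancels
    -- from both sides.
    have hJ : ∫ z, W.loss z.1 z.2 ∂ν ≤
        ∫ u, ∫ z, (W.perturb u).loss z.1 z.2 ∂ν ∂(linNetNoise d η) := by
      rw [integral_integral_swap hprod]
      exact integral_mono (W.integrable_loss hX4 hY4) hprod.integral_prod_right fun z =>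
        W.loss_le_integral_loss_perturb η z.1 z.2
    have := hJ.trans hb
    unfold linNetNoise at *
    linarith
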